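/- Let $q$ be a power of a prime (so $q\ge 2$), let $G$ be a finite abelian group of order $(q+1)(q^2+1)$, and let $D\subseteq G$ be a normalized difference set with classical parameters, that is, a subset with $$|D| = q^2+q+1,\qquad DD^{(-1)} = (q+1)\,G + q^2\cdot 1 \ \text{ in } \mathbb{Z}G,\qquad \prod_{d\in D} d = 1,$$ where a subset of $G$ also denotes the sum of its elements in the integral group ring $\mathbb{Z}G$ and $D^{(-1)}=\sum_{d\in D} d^{-1}$. (Thus $D$ is a $(v,k,\lambda)$-difference set with $(v,k,\lambda)=\left(\frac{q^4-1}{q-1},\frac{q^3-1}{q-1},\frac{q^2-1}{q-1}\right)$.) Then: 1. There is a unique subgroup $K$ of order $q^2+1$ in $G$. 2. $K$ has exactly $q+1$ cosets in $G$; there is one distinguished coset $Kx_0$ with $|D\cap Kx_0| = 1$, and $|D\cap Kx| = q+1$ for each of the other $q$ cosets $Kx$ of $K$. -/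

import Mathlib

namespace DiffSet

noncomputable section

/-- The element `∑_{d ∈ D} d` of the integral group ring `ℤG` attached to a finite subset `D`. -/
def groupRingSum {G : Type*} [Group G] (D : Finset G) : MonoidAlgebra ℤ G :=
  ∑ d ∈ D, MonoidAlgebra.single d (1 : ℤ)

/-- For `a = ∑ a_g g` in `ℤG`, the element `a^(-1) = ∑ a_g g⁻¹`. -/
def invMap {G : Type*} [Group G] (a : MonoidAlgebra ℤ G) : MonoidAlgebra ℤ G :=
  MonoidAlgebra.mapDomain (fun g : G => g⁻¹) a

/-- `D` is a `(v, k, lam)`-difference set in the finite group `G` of order `v`: a `k`-subset,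
`k ≥ 1`, with `D D^(-1) = lam G + n 1` in `ℤG`, where `n = k - lam` (an integer difference). -/
structure IsDifferenceSet {G : Type*} [Group G] [Fintype G] (D : Finset G)
    (v k lam : ℕ) : Prop where
  card_group : Nat.card G = v
  card_set : D.card = k
  one_le : 1 ≤ k
  mul_inv_eq : groupRingSum D * invMap (groupRingSum D) =
    (lam : ℤ) • groupRingSum (Finset.univ : Finset G) +
      ((k : ℤ) - (lam : ℤ)) • (1 : MonoidAlgebra ℤ G)

/-- `D` is a difference set with the classical parameters belonging to the prime power `q` and
the dimension `d ≥ 2`. All three divisions are exact. -/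
structure HasClassicalParameters {G : Type*} [Group G] [Fintype G] (D : Finset G)
    (q d : ℕ) : Prop where
  isPrimePow : IsPrimePow q
  two_le : 2 ≤ d
  isDifferenceSet : IsDifferenceSet D ((q ^ d - 1) / (q - 1)) ((q ^ (d - 1) - 1) / (q - 1))
    ((q ^ (d - 2) - 1) / (q - 1))

/-- A subset of an abelian group is normalized if the product of its elements is `1`. -/
def IsNormalized {G : Type*} [CommGroup G] (D : Finset G) : Prop :=
  ∏ d ∈ D, d = 1

/-- The coset `K x = {h x : h ∈ K}`. -/
def coset {G : Type*} [Group G] (K : Subgroup G) (x : G) : Set G :=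
  {g | ∃ h ∈ K, g = h * x}

/-- The intersection number `|D ∩ K x|`. -/
def interNumber {G : Type*} [Group G] (D : Finset G) (K : Subgroup G) (x : G) : ℕ :=
  ((D : Set G) ∩ coset K x).ncard

end

end DiffSet

/-! The prime `p` dividing `q` is a multiplier: `g ↦ g ^ p` carries `D` to a translate `g D`
(`exists_powRingHom_prime_eq_single_mul`). Comparing products of elements gives `g ^ |D| = 1` for
the normalized `D`, and `|D|` is coprime to `|G|`, so `g = 1`. Iterating, `D` is fixed by `g ↦ g ^
q`.

In a quotient `H` of exponent dividing `q + 1`, the `q`-th power is inversion, so the image `E` of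
`D` is symmetric and the difference set equation computes `E ^ 2`. If `q ^ 2` divides `(E - c H) ^
2`, then `q` divides `E - c H`, because `𝔽_p[H]` is reduced when `p ∤ |H|`
(`dvd_coeff_mapDomain_sub`).

For `H = G ⧸ K` and `c = 1` this makes all intersection numbers `1` modulo `q`; their sum and sum of
squares then leave only the stated distribution (`exists_eq_one_and_eq_add_one`). For uniqueness,
two subgroups of order `q ^ 2 + 1` meet in index `1` or `2`. Index `2` would give a quotient of
order `2 (q + 1)` in which every fibre of `D` has at least `(q + 1) / 2` elements, more than `D` can
supply (`two_mul_card_ne`). -/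

/-! ### Finite-order lifts of Frobenius -/

section FrobeniusLift

variable {R : Type*} [CommRing R] {p : ℕ} {φ : R →+* R}

theorem iterate_frobeniusLift_sub_pow (hφ : ∀ x, (p : R) ∣ φ x - x ^ p) (r : ℕ) (x : R) :
    (p : R) ∣ φ^[r] x - x ^ p ^ r := by
  induction r with
  | zero => simp
  | succ r ih =>
    rw [Function.iterate_succ_apply']
    have h1 : (p : R) ∣ φ (φ^[r] x) - φ x ^ p ^ r := by
      simpa using map_dvd φ ih
    have h2 : (p : R) ∣ φ x ^ p ^ r - (x ^ p) ^ p ^ r := (hφ x).trans (sub_dvd_pow_sub_pow _ _ _)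
    have := dvd_add h1 h2
    rwa [sub_add_sub_cancel, ← pow_mul, ← pow_succ'] at this

theorem dvd_pow_sub_self (hφ : ∀ x, (p : R) ∣ φ x - x ^ p) {r : ℕ} (hr : ∀ x, φ^[r] x = x)
    (x : R) : (p : R) ∣ x ^ p ^ r - x := by
  have := iterate_frobeniusLift_sub_pow hφ r x
  rw [hr] at this
  exact (dvd_sub_comm).1 this

/-- Modulo `p` every element equals its own `p ^ r`-th power, so `R / p` is reduced. -/
theorem dvd_of_dvd_sq (hp : 2 ≤ p) (hφ : ∀ x, (p : R) ∣ φ x - x ^ p) {r : ℕ} (hr0 : r ≠ 0)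
    (hr : ∀ x, φ^[r] x = x) {x : R} (hx : (p : R) ∣ x ^ 2) : (p : R) ∣ x := by
  have h2 : 2 ≤ p ^ r := hp.trans (Nat.le_self_pow hr0 p)
  have := dvd_pow_sub_self hφ hr x
  exact (dvd_sub_right (hx.trans (pow_dvd_pow x h2))).1 this

theorem pow_dvd_of_pow_dvd_sq (hp : 2 ≤ p) (htf : ∀ x : R, (p : R) * x = 0 → x = 0)
    (hφ : ∀ x, (p : R) ∣ φ x - x ^ p) {r : ℕ} (hr0 : r ≠ 0)
    (hr : ∀ x, φ^[r] x = x) (m : ℕ) {x : R} (hx : (p : R) ^ (2 * m) ∣ x ^ 2) :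
    (p : R) ^ m ∣ x := by
  induction m generalizing x with
  | zero => simp
  | succ m ih =>
    obtain ⟨y, rfl⟩ := dvd_of_dvd_sq hp hφ hr0 hr ((dvd_pow_self _ (by lia)).trans hx)
    obtain ⟨z, hz⟩ := hx
    have : y ^ 2 = (p : R) ^ (2 * m) * z := by
      refine sub_eq_zero.1 (htf _ (htf _ ?_))
      linear_combination hz
    rw [pow_succ']
    exact mul_dvd_mul_left _ (ih ⟨z, this⟩)

/-- The annihilator of `B` modulo `p ^ m` is stable under a finite-order lift of Frobenius. -/
theorem pow_dvd_frobeniusLift_mul (hp : 2 ≤ p) (htf : ∀ x : R, (p : R) * x = 0 → x = 0)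
    (hφ : ∀ x, (p : R) ∣ φ x - x ^ p) {r : ℕ} (hr0 : r ≠ 0)
    (hr : ∀ x, φ^[r] x = x) (m : ℕ) {A B : R} (h : (p : R) ^ m ∣ A * B) :
    (p : R) ^ m ∣ φ A * B := by
  induction m generalizing A B with
  | zero => simp
  | succ m ih =>
    have hcancel : ∀ {k : ℕ} {x : R}, (p : R) ^ (k + 1) ∣ p * x → (p : R) ^ k ∣ x := by
      rintro k x ⟨z, hz⟩
      exact ⟨z, sub_eq_zero.1 (htf _ (by linear_combination hz))⟩
    have h2 : 2 ≤ p ^ r := hp.trans (Nat.le_self_pow hr0 p)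
    obtain ⟨n, hn⟩ : ∃ n, p ^ r = n + 2 := ⟨p ^ r - 2, by lia⟩
    -- Since `A ^ (p ^ r) ≡ A`, the power `e = A ^ (p ^ r - 1)` is an idempotent modulo `p`
    -- generating the same ideal as `A`; hence it kills `B` and is fixed by `φ` modulo `p`.
    set e := A ^ (n + 1) with he
    have hself := dvd_pow_sub_self hφ hr
    have heA : (p : R) ∣ e * A - A := by
      simpa [he, ← pow_succ, hn] using hself A
    have heB : (p : R) ∣ e * B := by
      have : (p : R) ∣ A * B := (dvd_pow_self _ (by lia)).trans h
      rw [he, pow_succ, mul_assoc]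
      exact this.mul_left _
    have hee : (p : R) ∣ e ^ p - e := by
      have h1 : (p : R) ∣ e ^ 2 - e := by
        have : e ^ 2 - e = (e * A - A) * A ^ n := by rw [he]; ring
        rw [this]
        exact heA.mul_right _
      have h3 : ∀ k : ℕ, (p : R) ∣ e ^ (k + 1) - e := by
        intro k
        induction k with
        | zero => simp
        | succ k ihk =>
          have : e ^ (k + 1 + 1) - e = e * (e ^ (k + 1) - e) + (e ^ 2 - e) := by ring
          rw [this]
          exact dvd_add (ihk.mul_left _) h1
      obtain ⟨k, rfl⟩ : ∃ k, p = k + 1 := ⟨p - 1, by lia⟩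
      exact h3 k
    have hφe : (p : R) ∣ φ e - e := by
      simpa using dvd_add (hφ e) hee
    have hpows : ∀ k : ℕ, (p : R) ∣ e ^ p ^ k - e := by
      intro k
      induction k with
      | zero => simp
      | succ k ihk =>
        have : (p : R) ∣ (e ^ p) ^ p ^ k - e ^ p ^ k := hee.trans (sub_dvd_pow_sub_pow _ _ _)
        rw [← pow_mul, ← pow_succ'] at this
        simpa using dvd_add this ihk
    -- Raising to the power `p ^ m` improves the congruence `φ e ≡ e` from modulus `p` to `p ^ (m +
    -- 1)`, and `E ≡ e` modulo `p` still holds.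
    set E := e ^ p ^ m with hE
    have hφE : (p : R) ^ (m + 1) ∣ φ E - E := by
      rw [hE, map_pow]
      exact dvd_sub_pow_of_dvd_sub hφe m
    obtain ⟨u, hu⟩ := hpows m
    obtain ⟨A₁, hA₁⟩ : (p : R) ∣ (1 - E) * A := by
      have : (1 - E) * A = -(e * A - A) - (E - e) * A := by ring
      rw [this]
      exact dvd_sub ((dvd_neg).2 heA) ((hpows m).mul_right _)
    obtain ⟨B₁, hB₁⟩ : (p : R) ∣ E * B := by
      have : E * B = e * B + (E - e) * B := by ring
      rw [this]
      exact dvd_add heB ((hpows m).mul_right _)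
    have i1 : (p : R) ^ m ∣ φ A₁ * B := by
      refine ih (hcancel ?_)
      rw [← mul_assoc, ← hA₁, mul_assoc]
      exact h.mul_left _
    have i2 : (p : R) ^ m ∣ φ A * B₁ := by
      refine ih (hcancel ?_)
      have : (p : R) * (A * B₁) = E * (A * B) := by linear_combination (-A) * hB₁
      rw [this]
      exact h.mul_left _
    have hφA₁ : (1 - φ E) * φ A = p * φ A₁ := by
      simpa using congrArg φ hA₁
    -- Split by `1 = (1 - φ E) + E + (φ E - E)`: each of the first two terms yields a factor `p`,
    -- and the induction hypothesis supplies the rest.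
    have : φ A * B = p * (φ A₁ * B) + p * (φ A * B₁) + (φ E - E) * (φ A * B) := by
      linear_combination B * hφA₁ + φ A * hB₁
    rw [this]
    refine dvd_add (dvd_add ?_ ?_) (hφE.mul_right _)
    · rw [pow_succ']; exact mul_dvd_mul_left _ i1
    · rw [pow_succ']; exact mul_dvd_mul_left _ i2

end FrobeniusLift

/-! ### Converse of Lagrange's theorem for finite abelian groups -/

theorem CommGroup.exists_subgroup_card {G : Type*} [CommGroup G] [Finite G] {d : ℕ}
    (hd : d ∣ Nat.card G) : ∃ K : Subgroup G, Nat.card K = d := by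
  induction d using Nat.strong_induction_on generalizing G with
  | _ d ih =>
    by_cases h1 : d = 1
    · exact ⟨⊥, by simp [h1]⟩
    obtain ⟨p, hp, m, rfl⟩ := Nat.exists_prime_and_dvd h1
    have := Fact.mk hp
    obtain ⟨g, hg⟩ := exists_prime_orderOf_dvd_card' p ((dvd_mul_right p m).trans hd)
    have hP : Nat.card (Subgroup.zpowers g) = p := by rw [Nat.card_zpowers, hg]
    have hcard := Subgroup.card_eq_card_quotient_mul_card_subgroup (Subgroup.zpowers g)
    have hm0 : m ≠ 0 := by
      rintro rfl
      exact Nat.card_pos.ne' (Nat.eq_zero_of_zero_dvd (by simpa using hd))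
    have hm : m ∣ Nat.card (G ⧸ Subgroup.zpowers g) := by
      rw [hcard, hP, mul_comm p] at hd
      exact Nat.dvd_of_mul_dvd_mul_right hp.pos hd
    obtain ⟨L, hL⟩ := ih m (by nlinarith [hp.two_le, Nat.pos_of_ne_zero hm0]) hm
    refine ⟨L.comap (QuotientGroup.mk' _), ?_⟩
    have h := QuotientGroup.card_preimage_mk (Subgroup.zpowers g) (L : Set (G ⧸ Subgroup.zpowers g))
    rw [hP] at h
    exact h.trans (congrArg (p * ·) hL)

namespace DiffSet

open MonoidAlgebra

/-! ### Power maps and augmentation on the integral group ring -/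

section GroupRing

variable {G : Type*} [CommGroup G]

/-- The ring endomorphism `g ↦ g ^ n` of `ℤG`. -/
noncomputable def powRingHom (G : Type*) [CommGroup G] (n : ℕ) :
    MonoidAlgebra ℤ G →+* MonoidAlgebra ℤ G :=
  mapDomainRingHom ℤ (powMonoidHom n)

@[simp]
theorem powRingHom_single (n : ℕ) (g : G) (a : ℤ) :
    powRingHom G n (single g a) = single (g ^ n) a := by
  simp [powRingHom]

/-- The binomial theorem modulo `p` reduces this to monomials, where it is Fermat's little theorem.
The power map is thus a lift of Frobenius. -/
theorem dvd_powRingHom_sub_pow {p : ℕ} (hp : p.Prime) (x : MonoidAlgebra ℤ G) :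
    (p : MonoidAlgebra ℤ G) ∣ powRingHom G p x - x ^ p := by
  have := Fact.mk hp
  have hadd : ∀ x y : MonoidAlgebra ℤ G, (p : MonoidAlgebra ℤ G) ∣ powRingHom G p x - x ^ p →
      (p : MonoidAlgebra ℤ G) ∣ powRingHom G p y - y ^ p →
      (p : MonoidAlgebra ℤ G) ∣ powRingHom G p (x + y) - (x + y) ^ p := by
    intro x y hx hy
    obtain ⟨z, hz⟩ := exists_add_pow_prime_eq hp x y
    have : powRingHom G p (x + y) - (x + y) ^ p = (powRingHom G p x - x ^ p) +
        (powRingHom G p y - y ^ p) - p * (x * y * z) := by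
      rw [hz, map_add]; ring
    rw [this]
    exact dvd_sub (dvd_add hx hy) (dvd_mul_right _ _)
  have hsingle : ∀ (g : G) (a : ℤ), (p : MonoidAlgebra ℤ G) ∣
      powRingHom G p (single g a) - single g a ^ p := by
    intro g a
    obtain ⟨b, hb⟩ : (p : ℤ) ∣ a - a ^ p := by
      rw [← ZMod.intCast_zmod_eq_zero_iff_dvd]
      simp [ZMod.pow_card]
    refine ⟨single (g ^ p) b, ?_⟩
    rw [powRingHom_single, single_pow, ← single_sub, hb, natCast_def, single_mul_single, one_mul]
  have hall := fun f : G →₀ ℤ => Finsupp.induction_linear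
    (motive := fun f => (p : MonoidAlgebra ℤ G) ∣
      powRingHom G p (ofCoeff f) - ofCoeff f ^ p) f
    (by simp [hp.ne_zero]) (fun f g hf hg => by simpa using hadd _ _ hf hg)
    (fun g a => by simpa using hsingle g a)
  exact hall x.coeff

theorem powRingHom_powRingHom (m n : ℕ) (x : MonoidAlgebra ℤ G) :
    powRingHom G m (powRingHom G n x) = powRingHom G (n * m) x := by
  have : (powRingHom G m).comp (powRingHom G n) = powRingHom G (n * m) := by
    apply ringHom_ext
    · intro r; simp
    · intro g; simp [pow_mul]
  exact congrArg (fun f => f x) this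

theorem powRingHom_one (x : MonoidAlgebra ℤ G) : powRingHom G 1 x = x := by
  have : powRingHom G 1 = RingHom.id _ := by
    apply ringHom_ext <;> simp
  rw [this, RingHom.id_apply]

theorem iterate_powRingHom (n r : ℕ) (x : MonoidAlgebra ℤ G) :
    (powRingHom G n)^[r] x = powRingHom G (n ^ r) x := by
  induction r with
  | zero => simp [powRingHom_one]
  | succ r ih => rw [Function.iterate_succ_apply', ih, powRingHom_powRingHom, pow_succ]

/-- By Euler's theorem, `φ(|G|)` iterations suffice. -/
theorem exists_iterate_powRingHom_eq_self [Finite G] {p : ℕ} (hp : p.Coprime (Nat.card G)) :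
    ∃ r ≠ 0, ∀ x, (powRingHom G p)^[r] x = x := by
  refine ⟨(Nat.card G).totient, (Nat.totient_pos.2 Nat.card_pos).ne', fun x => ?_⟩
  rw [iterate_powRingHom]
  have : powRingHom G (p ^ (Nat.card G).totient) = RingHom.id _ := by
    apply ringHom_ext
    · intro r; simp
    · intro g
      have h : p ^ (Nat.card G).totient ≡ 1 [MOD orderOf g] :=
        (Nat.ModEq.pow_totient hp).of_dvd (orderOf_dvd_natCard g)
      have := pow_eq_pow_iff_modEq.2 h
      simp [this]
  rw [this, RingHom.id_apply]

theorem coeff_natCast_mul (n : ℕ) (x : MonoidAlgebra ℤ G) (g : G) :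
    (n * x).coeff g = n * x.coeff g := by
  rw [natCast_def, coeff_single_one_mul]

theorem natCast_mul_eq_zero {n : ℕ} (hn : n ≠ 0) (x : MonoidAlgebra ℤ G) (h : n * x = 0) :
    x = 0 := by
  ext g
  have := congrArg (fun y => y.coeff g) h
  simpa [coeff_natCast_mul, hn] using this

theorem dvd_coeff {n : ℕ} {x : MonoidAlgebra ℤ G} (h : (n : MonoidAlgebra ℤ G) ∣ x) (g : G) :
    (n : ℤ) ∣ x.coeff g := by
  obtain ⟨y, rfl⟩ := h
  exact ⟨y.coeff g, coeff_natCast_mul n y g⟩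

/-- The augmentation `∑ a_g g ↦ ∑ a_g`. -/
noncomputable def augmentation (G : Type*) [CommGroup G] : MonoidAlgebra ℤ G →+* ℤ :=
  (MonoidAlgebra.lift ℤ ℤ G 1).toRingHom

@[simp]
theorem augmentation_single (g : G) (a : ℤ) : augmentation G (single g a) = a := by
  simp [augmentation, lift_single]

theorem augmentation_eq_sum [Fintype G] (x : MonoidAlgebra ℤ G) :
    augmentation G x = ∑ g, x.coeff g := by
  conv_lhs => rw [← sum_coeff_single x]
  rw [Finsupp.sum_fintype _ _ (by simp), map_sum]
  simp

@[simp]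
theorem augmentation_groupRingSum (D : Finset G) : augmentation G (groupRingSum D) = D.card := by
  simp [groupRingSum]

theorem mul_groupRingSum_univ [Fintype G] (x : MonoidAlgebra ℤ G) :
    x * groupRingSum Finset.univ = augmentation G x • groupRingSum Finset.univ := by
  have hsingle : ∀ (g : G) (a : ℤ), single g a * groupRingSum Finset.univ =
      a • groupRingSum (Finset.univ : Finset G) := by
    intro g a
    simp only [groupRingSum, Finset.mul_sum, Finset.smul_sum, single_mul_single, smul_single]
    rw [Fintype.sum_equiv (Equiv.mulLeft g)]
    simp
  have hall := fun f : G →₀ ℤ => Finsupp.induction_linear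
    (motive := fun f => ofCoeff f * groupRingSum Finset.univ =
      augmentation G (ofCoeff f) • groupRingSum Finset.univ) f
    (by simp) (fun f g hf hg => by simp [add_mul, add_smul, hf, hg])
    (fun g a => by simpa using hsingle g a)
  exact hall x.coeff

theorem coeff_groupRingSum [DecidableEq G] (D : Finset G) (g : G) :
    (groupRingSum D).coeff g = if g ∈ D then 1 else 0 := by
  simp [groupRingSum, Finsupp.single_apply]

theorem groupRingSum_injective : Function.Injective (groupRingSum : Finset G → _) := by
  classical
  intro D E h
  ext g
  have := congrArg (fun x => x.coeff g) h
  simp only [coeff_groupRingSum] at this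
  split_ifs at this <;> simp_all

theorem mapDomain_groupRingSum {H : Type*} [CommGroup H] (f : G →* H) (D : Finset G) :
    mapDomainRingHom ℤ f (groupRingSum D) = ∑ d ∈ D, single (f d) 1 := by
  simp [groupRingSum]

theorem powRingHom_groupRingSum [DecidableEq G] [Finite G] {n : ℕ} (hn : n.Coprime (Nat.card G))
    (D : Finset G) : powRingHom G n (groupRingSum D) = groupRingSum (D.image (· ^ n)) := by
  rw [groupRingSum, groupRingSum, map_sum, Finset.sum_image]
  · simp
  · exact fun x _ y _ h => (powCoprime hn.symm).injective h

theorem single_mul_groupRingSum [DecidableEq G] (g : G) (D : Finset G) :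
    single g 1 * groupRingSum D = groupRingSum (D.image (g * ·)) := by
  rw [groupRingSum, groupRingSum, Finset.mul_sum, Finset.sum_image]
  · simp [single_mul_single]
  · exact fun x _ y _ h => mul_left_cancel h

end GroupRing

theorem invMap_groupRingSum {G : Type*} [CommGroup G] (D : Finset G) :
    invMap (groupRingSum D) = ∑ d ∈ D, single d⁻¹ 1 := by
  have : ∀ x : MonoidAlgebra ℤ G, invMap x = mapDomainRingHom ℤ (invMonoidHom : G →* G) x := by
    intro x; rfl
  rw [this, mapDomain_groupRingSum]
  rfl

theorem coprime_pow_add_one_mul_sq_add_one {p s : ℕ} (hp : p.Prime) (hs : s ≠ 0) :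
    p.Coprime ((p ^ s + 1) * ((p ^ s) ^ 2 + 1)) := by
  have hpq : p ∣ p ^ s := dvd_pow_self p hs
  rw [hp.coprime_iff_not_dvd, hp.dvd_mul, Nat.dvd_add_right hpq,
    Nat.dvd_add_right (hpq.trans (dvd_pow_self _ two_ne_zero))]
  simp [hp.ne_one]

/-! ### The multiplier theorem -/

section Multiplier

variable {G : Type*} [CommGroup G]

theorem augmentation_powRingHom (n : ℕ) (x : MonoidAlgebra ℤ G) :
    augmentation G (powRingHom G n x) = augmentation G x := by
  have : (augmentation G).comp (powRingHom G n) = augmentation G := by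
    apply ringHom_ext <;> simp
  exact congrArg (fun f => f x) this

theorem augmentation_invMap_groupRingSum (D : Finset G) :
    augmentation G (invMap (groupRingSum D)) = D.card := by
  simp [invMap_groupRingSum]

theorem eq_single_of_nonneg_of_augmentation_eq_one [Fintype G] {x : MonoidAlgebra ℤ G}
    (h0 : ∀ g, 0 ≤ x.coeff g) (h1 : augmentation G x = 1) : ∃ g, x = single g 1 := by
  classical
  rw [augmentation_eq_sum] at h1
  obtain ⟨g, hg⟩ : ∃ g, x.coeff g ≠ 0 := by
    by_contra! h
    simp [h] at h1
  refine ⟨g, ?_⟩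
  rw [← Finset.add_sum_erase _ _ (Finset.mem_univ g)] at h1
  have hnn : 0 ≤ ∑ i ∈ Finset.univ.erase g, x.coeff i := Finset.sum_nonneg fun i _ => h0 i
  have hgp := h0 g
  have hz : ∑ i ∈ Finset.univ.erase g, x.coeff i = 0 := by lia
  have hg1 : x.coeff g = 1 := by lia
  rw [Finset.sum_eq_zero_iff_of_nonneg fun i _ => h0 i] at hz
  ext i
  by_cases hi : i = g
  · simp [hi, hg1]
  · simp [hz i (by simp [hi]), Ne.symm hi]

theorem coeff_mul_nonneg {x y : MonoidAlgebra ℤ G} (hx : ∀ g, 0 ≤ x.coeff g)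
    (hy : ∀ g, 0 ≤ y.coeff g) (g : G) : 0 ≤ (x * y).coeff g := by
  rw [coeff_mul_apply_left, Finsupp.sum]
  exact Finset.sum_nonneg fun i _ => mul_nonneg (hx i) (hy _)

theorem coeff_sum_single_nonneg {ι G : Type*} (s : Finset ι) (f : ι → G)
    (g : G) : 0 ≤ (∑ i ∈ s, single (f i) (1 : ℤ)).coeff g := by
  classical
  simp only [coeff_sum, coeff_single, Finsupp.coe_finsetSum, Finset.sum_apply]
  refine Finset.sum_nonneg fun i _ => ?_
  rw [Finsupp.single_apply]
  split_ifs <;> simp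

/-- A prime `p` with `q = p ^ s` is a multiplier of a difference set with parameters
`((q + 1) (q ^ 2 + 1), q ^ 2 + q + 1, q + 1)`. -/
theorem exists_powRingHom_prime_eq_single_mul [Fintype G] {p s : ℕ} (hp : p.Prime) (hs : s ≠ 0) {D : Finset G}
    (hv : Nat.card G = (p ^ s + 1) * ((p ^ s) ^ 2 + 1))
    (hk : D.card = (p ^ s) ^ 2 + p ^ s + 1)
    (hD : groupRingSum D * invMap (groupRingSum D) =
      ((p ^ s + 1 : ℕ) : ℤ) • groupRingSum Finset.univ +
        (((p ^ s) ^ 2 : ℕ) : ℤ) • (1 : MonoidAlgebra ℤ G)) :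
    ∃ g, powRingHom G p (groupRingSum D) = single g 1 * groupRingSum D := by
  classical
  set q := p ^ s with hq
  have hq2 : 2 ≤ q := hp.two_le.trans (Nat.le_self_pow hs p)
  have hcop : p.Coprime (Nat.card G) := hv ▸ coprime_pow_add_one_mul_sq_add_one hp hs
  set S : MonoidAlgebra ℤ G := groupRingSum Finset.univ with hS
  set A := groupRingSum D
  set B := invMap (groupRingSum D) with hB
  have hεA : augmentation G A = (q : ℤ) ^ 2 + q + 1 := by simp [A, hk]
  have hεB : augmentation G B = (q : ℤ) ^ 2 + q + 1 := by
    rw [hB, augmentation_invMap_groupRingSum, hk]; push_cast; rfl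
  have hεS : augmentation G S = ((q : ℤ) + 1) * (q ^ 2 + 1) := by
    rw [hS, augmentation_groupRingSum, Finset.card_univ, ← Nat.card_eq_fintype_card, hv]
    push_cast; rfl
  have hAS : ∀ x, x * S = (augmentation G x : MonoidAlgebra ℤ G) * S := by
    intro x
    rw [hS, mul_groupRingSum_univ, zsmul_eq_mul]
  have hD' : A * B = ((q : MonoidAlgebra ℤ G) + 1) * S + q ^ 2 := by
    rw [hD, zsmul_eq_mul, zsmul_eq_mul]; push_cast; ring
  have hBS : S * B = ((q : MonoidAlgebra ℤ G) ^ 2 + q + 1) * S := by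
    rw [mul_comm S, hAS, hεB]; push_cast; rfl
  obtain ⟨r, hr0, hr⟩ := exists_iterate_powRingHom_eq_self (G := G) hcop
  -- Subtracting `S` replaces the coefficient `q + 1` of `S` in `A * B` by `-q ^ 2`, so the whole
  -- product is divisible by `q ^ 2`.
  have hdvd : (p : MonoidAlgebra ℤ G) ^ (s * 2) ∣ (A - S) * B := by
    refine ⟨1 - S, ?_⟩
    rw [pow_mul, ← Nat.cast_pow, ← hq, sub_mul, hD', hBS]
    ring
  have hstab := pow_dvd_frobeniusLift_mul hp.two_le
    (fun x => natCast_mul_eq_zero hp.ne_zero x) (dvd_powRingHom_sub_pow hp) hr0 hr _ hdvd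
  rw [pow_mul, ← Nat.cast_pow, ← hq, map_sub] at hstab
  have hφS : powRingHom G p S = S := by
    rw [hS, powRingHom_groupRingSum hcop]
    exact congrArg _ (Finset.image_univ_of_surjective (powCoprime hcop.symm).surjective)
  rw [hφS, sub_mul, hBS] at hstab
  obtain ⟨U, hU⟩ := hstab
  have hφ : powRingHom G p A * B = ((q : MonoidAlgebra ℤ G) + 1) * S + q ^ 2 * (U + S) := by
    linear_combination hU
  have hq0 : (q : ℤ) ^ 2 ≠ 0 := by positivity
  have hε : augmentation G (U + S) = 1 := by
    have := congrArg (augmentation G) hφ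
    simp only [map_mul, map_add, map_pow, map_natCast, map_one, augmentation_powRingHom, hεA, hεB,
      hεS] at this
    rw [map_add, hεS]
    apply mul_left_cancel₀ hq0
    linear_combination -this
  have hnonneg : ∀ g, 0 ≤ (U + S).coeff g := by
    intro g
    have h1 : 0 ≤ (powRingHom G p A * B).coeff g := by
      refine coeff_mul_nonneg (fun g => ?_) (fun g => ?_) g
      · rw [powRingHom_groupRingSum hcop]
        exact coeff_sum_single_nonneg _ _ g
      · rw [hB, invMap_groupRingSum]
        exact coeff_sum_single_nonneg _ _ g
    have h2 : (powRingHom G p A * B).coeff g = q + 1 + q ^ 2 * (U + S).coeff g := by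
      have : powRingHom G p A * B = ((q + 1 : ℕ) : MonoidAlgebra ℤ G) * S +
          ((q ^ 2 : ℕ) : MonoidAlgebra ℤ G) * (U + S) := by
        rw [hφ]; push_cast; rfl
      rw [this, coeff_add, Finsupp.add_apply, coeff_natCast_mul, coeff_natCast_mul, hS,
        coeff_groupRingSum]
      simp
    -- A coefficient of `U + S` at most `-1` would give `q + 1 - q ^ 2 ≥ 0`, false for `q ≥ 2`.
    by_contra! hneg
    have : (q : ℤ) ^ 2 * (U + S).coeff g ≤ q ^ 2 * (-1) :=
      mul_le_mul_of_nonneg_left (by lia) (by positivity)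
    have hq2' : (2 : ℤ) ≤ q := by exact_mod_cast hq2
    nlinarith
  obtain ⟨g, hg⟩ := eq_single_of_nonneg_of_augmentation_eq_one hnonneg hε
  refine ⟨g, ?_⟩
  have hφA : powRingHom G p A * S = A * S := by
    rw [hAS, hAS A, augmentation_powRingHom]
  rw [hg] at hφ
  -- Multiply `φ A * B = (q + 1) S + q ^ 2 g` by `A` and expand `A * B`; the `S` terms cancel as `φ
  -- A` and `A` have equal augmentation.
  have hkey : ((q ^ 2 : ℕ) : MonoidAlgebra ℤ G) * (powRingHom G p A - single g 1 * A) = 0 := by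
    push_cast
    linear_combination A * hφ - powRingHom G p A * hD' - (q + 1 : MonoidAlgebra ℤ G) * hφA
  exact sub_eq_zero.1 (natCast_mul_eq_zero (by positivity) _ hkey)

theorem powRingHom_eq_self_of_isNormalized [Fintype G] {q : ℕ} (hq : IsPrimePow q) {D : Finset G}
    (hv : Nat.card G = (q + 1) * (q ^ 2 + 1)) (hk : D.card = q ^ 2 + q + 1)
    (hD : groupRingSum D * invMap (groupRingSum D) = ((q + 1 : ℕ) : ℤ) • groupRingSum Finset.univ +
        ((q ^ 2 : ℕ) : ℤ) • (1 : MonoidAlgebra ℤ G)) (hnorm : IsNormalized D) :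
    powRingHom G q (groupRingSum D) = groupRingSum D := by
  classical
  obtain ⟨p, s, hp', hs, rfl⟩ := hq
  have hp := hp'.nat_prime
  obtain ⟨g, hg⟩ := exists_powRingHom_prime_eq_single_mul hp hs.ne' hv hk hD
  set q := p ^ s with hq
  have hcop : p.Coprime (Nat.card G) := hv ▸ coprime_pow_add_one_mul_sq_add_one hp hs.ne'
  have hg1 : g = 1 := by
    have himage := hg
    rw [powRingHom_groupRingSum hcop, single_mul_groupRingSum] at himage
    have himage := congrArg (fun s => ∏ x ∈ s, x) (groupRingSum_injective himage)
    have hinj : Function.Injective fun x : G => x ^ p := (powCoprime hcop.symm).injective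
    rw [Finset.prod_image hinj.injOn, Finset.prod_image (mul_right_injective g).injOn, Finset.prod_pow,
      Finset.prod_mul_distrib, hnorm, Finset.prod_const, hk] at himage
    have h1 : orderOf g ∣ q ^ 2 + q + 1 := orderOf_dvd_of_pow_eq_one (by simpa using himage.symm)
    have h2 : orderOf g ∣ (q + 1) * (q ^ 2 + 1) := hv ▸ orderOf_dvd_natCard g
    have hc : Nat.Coprime (q ^ 2 + q + 1) ((q + 1) * (q ^ 2 + 1)) := by
      rw [← Nat.isCoprime_iff_coprime]
      push_cast
      exact ⟨-q, 1, by ring⟩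
    exact orderOf_eq_one_iff.1 (Nat.eq_one_of_dvd_coprimes hc h1 h2)
  rw [hg1, ← one_def, one_mul] at hg
  rw [hq, ← iterate_powRingHom]
  exact Function.iterate_fixed hg s

end Multiplier

/-! ### Images in quotients of exponent dividing `q + 1` -/

section Quotient

variable {G : Type*} [CommGroup G] {H : Type*} [CommGroup H]

theorem coeff_mapDomain_groupRingSum [DecidableEq H] (f : G →* H) (D : Finset G) (x : H) :
    (mapDomainRingHom ℤ f (groupRingSum D)).coeff x = {d ∈ D | f d = x}.card := by
  rw [mapDomain_groupRingSum]
  simp [Finsupp.single_apply]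

theorem mapDomain_powRingHom (f : G →* H) (n : ℕ) (x : MonoidAlgebra ℤ G) :
    mapDomainRingHom ℤ f (powRingHom G n x) = powRingHom H n (mapDomainRingHom ℤ f x) := by
  have : (mapDomainRingHom ℤ f).comp (powRingHom G n) =
      (powRingHom H n).comp (mapDomainRingHom ℤ f) := by
    apply ringHom_ext <;> simp
  exact congrArg (fun f => f x) this

theorem mapDomain_invMap_eq (f : G →* H) {q : ℕ} (hf : ∀ g, f g ^ (q + 1) = 1) {D : Finset G}
    (hfix : powRingHom G q (groupRingSum D) = groupRingSum D) :
    mapDomainRingHom ℤ f (invMap (groupRingSum D)) = mapDomainRingHom ℤ f (groupRingSum D) := by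
  conv_rhs => rw [← hfix]
  rw [mapDomain_powRingHom, mapDomain_groupRingSum, invMap_groupRingSum, map_sum, map_sum]
  refine Finset.sum_congr rfl fun d _ => ?_
  have : f d ^ q = (f d)⁻¹ := by
    rw [eq_inv_iff_mul_eq_one, ← pow_succ, hf]
  simp [this]

theorem mapDomain_groupRingSum_univ [Fintype G] [Fintype H] (f : G →* H)
    (hf : Function.Surjective f) : mapDomainRingHom ℤ f (groupRingSum Finset.univ) =
      (Nat.card f.ker : ℤ) • groupRingSum Finset.univ := by
  classical
  ext x
  rw [coeff_mapDomain_groupRingSum, coeff_smul, Finsupp.smul_apply, coeff_groupRingSum]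
  obtain ⟨g, rfl⟩ := hf x
  simp only [Finset.mem_univ, if_true, smul_eq_mul, mul_one, Nat.cast_inj]
  rw [← Fintype.card_subtype, ← Nat.card_eq_fintype_card]
  exact Nat.card_congr (f.fiberEquivKerOfSurjective hf (f g))

/-- The image of a `q`-invariant difference set `D` in a quotient of exponent dividing `q + 1`
has square `(q + 1) |ker f| H + q ^ 2`. -/
theorem mapDomain_mul_self [Fintype G] [Fintype H] (f : G →* H) (hsurj : Function.Surjective f)
    {q : ℕ} (hf : ∀ g, f g ^ (q + 1) = 1) {D : Finset G}
    (hfix : powRingHom G q (groupRingSum D) = groupRingSum D)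
    (hD : groupRingSum D * invMap (groupRingSum D) = ((q + 1 : ℕ) : ℤ) • groupRingSum Finset.univ +
        ((q ^ 2 : ℕ) : ℤ) • (1 : MonoidAlgebra ℤ G)) :
    mapDomainRingHom ℤ f (groupRingSum D) * mapDomainRingHom ℤ f (groupRingSum D) =
      (((q + 1) * Nat.card f.ker : ℕ) : MonoidAlgebra ℤ H) * groupRingSum Finset.univ + (q : MonoidAlgebra ℤ H) ^ 2 := by
  have := congrArg (mapDomainRingHom ℤ f) hD
  rw [map_mul, mapDomain_invMap_eq f hf hfix, map_add, map_zsmul, map_zsmul, map_one,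
    mapDomain_groupRingSum_univ f hsurj] at this
  rw [this]
  simp only [zsmul_eq_mul]
  push_cast
  ring

/-- With `E` the image of `D` and `S` the sum over `H`, the integer in `hc` is the coefficient of
`S` in `(E - c S) ^ 2 - q ^ 2`. So `q ^ 2` divides that square, and the square root can be taken
modulo `q`. -/
theorem dvd_coeff_mapDomain_sub [Fintype G] [Fintype H] (f : G →* H)
    (hsurj : Function.Surjective f) {q : ℕ} (hq : IsPrimePow q) (hcop : q.Coprime (Nat.card G))
    (hf : ∀ g, f g ^ (q + 1) = 1) {D : Finset G}
    (hfix : powRingHom G q (groupRingSum D) = groupRingSum D)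
    (hD : groupRingSum D * invMap (groupRingSum D) = ((q + 1 : ℕ) : ℤ) • groupRingSum Finset.univ +
        ((q ^ 2 : ℕ) : ℤ) • (1 : MonoidAlgebra ℤ G))
    {c : ℤ} (hc : (q : ℤ) ^ 2 ∣ (q + 1) * Nat.card f.ker - 2 * c * D.card + c ^ 2 * Nat.card H)
    (x : H) : (q : ℤ) ∣ (mapDomainRingHom ℤ f (groupRingSum D)).coeff x - c := by
  classical
  obtain ⟨p, s, hp', hs, rfl⟩ := hq
  have hp := hp'.nat_prime
  have hcopH : p.Coprime (Nat.card H) :=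
    ((Nat.coprime_pow_left_iff hs _ _).1 hcop).coprime_dvd_right (Subgroup.card_dvd_of_surjective f hsurj)
  obtain ⟨r, hr0, hr⟩ := exists_iterate_powRingHom_eq_self hcopH
  have hsq := mapDomain_mul_self f hsurj hf hfix hD
  set E := mapDomainRingHom ℤ f (groupRingSum D) with hE
  set S : MonoidAlgebra ℤ H := groupRingSum Finset.univ with hS
  have hεE : augmentation H E = D.card := by
    rw [hE, mapDomain_groupRingSum]; simp
  have hES : E * S = D.card * S := by
    rw [hS, mul_groupRingSum_univ, hεE, zsmul_eq_mul]; simp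
  have hSS : S * S = Nat.card H * S := by
    rw [hS, mul_groupRingSum_univ, augmentation_groupRingSum, zsmul_eq_mul]; simp
  obtain ⟨t, ht⟩ := hc
  have ht' := congrArg (Int.cast : ℤ → MonoidAlgebra ℤ H) ht
  have hdvd : (p : MonoidAlgebra ℤ H) ^ (2 * s) ∣ (E - (c : MonoidAlgebra ℤ H) * S) ^ 2 := by
    refine ⟨1 + t * S, ?_⟩
    push_cast at ht' hsq ⊢
    rw [mul_comm 2 s, pow_mul]
    linear_combination hsq - 2 * c * hES + c ^ 2 * hSS + S * ht'
  have := pow_dvd_of_pow_dvd_sq hp.two_le (fun x => natCast_mul_eq_zero hp.ne_zero x)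
    (dvd_powRingHom_sub_pow hp) hr0 hr s hdvd
  rw [← Nat.cast_pow] at this
  have := dvd_coeff this x
  rwa [← zsmul_eq_mul, coeff_sub, Finsupp.sub_apply, coeff_smul, Finsupp.smul_apply, hS,
    coeff_groupRingSum, if_pos (Finset.mem_univ x), smul_eq_mul, mul_one] at this

/-- As the image of `D` is symmetric, the sum of squares is the coefficient of its square at the
identity. -/
theorem sum_card_fiber_sq [Fintype G] [Fintype H] [DecidableEq H] (f : G →* H)
    (hsurj : Function.Surjective f) {q : ℕ} (hf : ∀ g, f g ^ (q + 1) = 1) {D : Finset G}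
    (hfix : powRingHom G q (groupRingSum D) = groupRingSum D)
    (hD : groupRingSum D * invMap (groupRingSum D) = ((q + 1 : ℕ) : ℤ) • groupRingSum Finset.univ +
        ((q ^ 2 : ℕ) : ℤ) • (1 : MonoidAlgebra ℤ G)) :
    ∑ x, {d ∈ D | f d = x}.card ^ 2 = (q + 1) * Nat.card f.ker + q ^ 2 := by
  have hsq := mapDomain_mul_self f hsurj hf hfix hD
  have hinv : ∀ x, (mapDomainRingHom ℤ f (groupRingSum D)).coeff x⁻¹ =
      (mapDomainRingHom ℤ f (groupRingSum D)).coeff x := by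
    intro x
    conv_rhs => rw [← mapDomain_invMap_eq f hf hfix, invMap_groupRingSum]
    rw [coeff_mapDomain_groupRingSum]
    simp [Finsupp.single_apply, inv_eq_iff_eq_inv]
  have h1 := congrArg (fun y => y.coeff 1) hsq
  rw [coeff_mul_apply_left, Finsupp.sum_fintype _ _ (by simp), coeff_add, Finsupp.add_apply,
    coeff_natCast_mul, coeff_groupRingSum, if_pos (Finset.mem_univ _), mul_one,
    ← Nat.cast_pow, coeff_natCast, Finsupp.single_eq_same] at h1
  simp only [mul_one, hinv, coeff_mapDomain_groupRingSum] at h1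
  simp only [sq]
  zify
  simp only [sq] at h1
  exact_mod_cast h1

end Quotient

/-! ### Cosets as fibres of the quotient map -/

section Cosets

variable {G : Type*} [CommGroup G]

theorem mem_coset_iff {K : Subgroup G} {x g : G} :
    g ∈ coset K x ↔ (g : G ⧸ K) = (x : G ⧸ K) := by
  rw [eq_comm, QuotientGroup.eq]
  constructor
  · rintro ⟨h, hh, rfl⟩
    simpa [mul_comm] using hh
  · exact fun h => ⟨_, h, by simp [mul_comm]⟩

theorem coset_eq_coset_iff {K : Subgroup G} {x y : G} :
    coset K x = coset K y ↔ (x : G ⧸ K) = (y : G ⧸ K) := by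
  constructor
  · intro h
    rw [← mem_coset_iff, ← h, mem_coset_iff]
  · intro h
    ext g
    rw [mem_coset_iff, mem_coset_iff, h]

theorem interNumber_eq_card {K : Subgroup G} [DecidableEq (G ⧸ K)] (D : Finset G) (x : G) :
    interNumber D K x = {d ∈ D | QuotientGroup.mk' K d = QuotientGroup.mk' K x}.card := by
  rw [interNumber, ← Set.ncard_coe_finset]
  congr 1
  ext g
  rw [Finset.mem_coe, Finset.mem_filter]
  simp [mem_coset_iff]

theorem ncard_range_coset (K : Subgroup G) :
    (Set.range (coset K)).ncard = Nat.card (G ⧸ K) := by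
  have hf : ∀ x y, coset K x = coset K y ↔ QuotientGroup.mk' K x = QuotientGroup.mk' K y :=
    fun x y => coset_eq_coset_iff
  rw [← Nat.card_coe_set_eq]
  symm
  refine Nat.card_congr (Equiv.ofBijective
    (Quotient.lift (fun x => (⟨coset K x, x, rfl⟩ : Set.range (coset K)))
      (fun x y h => Subtype.ext (coset_eq_coset_iff.2 (Quotient.sound h)))) ⟨?_, ?_⟩)
  · rintro ⟨x⟩ ⟨y⟩ h
    exact coset_eq_coset_iff.1 (congrArg Subtype.val h)
  · rintro ⟨_, x, rfl⟩
    exact ⟨(x : G ⧸ K), rfl⟩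

end Cosets

/-! ### Counting argument and classical parameters -/

/-- If `q + 1` natural numbers congruent to `1` modulo `q` have sum `q ^ 2 + q + 1` and sum of
squares `(q + 1) (q ^ 2 + 1) + q ^ 2`, then one of them is `1` and the others are `q + 1`. -/
theorem exists_eq_one_and_eq_add_one {ι : Type*} [Fintype ι] {q : ℕ} (hq : 2 ≤ q) {e : ι → ℕ}
    (hcard : Fintype.card ι = q + 1) (hmod : ∀ i, (q : ℤ) ∣ (e i : ℤ) - 1)
    (hsum : ∑ i, e i = q ^ 2 + q + 1)
    (hsq : ∑ i, e i ^ 2 = (q + 1) * (q ^ 2 + 1) + q ^ 2) :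
    ∃ i₀, e i₀ = 1 ∧ ∀ i, i ≠ i₀ → e i = q + 1 := by
  classical
  -- With `e i = 1 + q * f i`, the two sums give `∑ f i = ∑ f i ^ 2 = q`, so each `f i` is `0` or
  -- `1`, and exactly one of the `q + 1` values is `0`.
  choose f hf using hmod
  have he : ∀ i, (e i : ℤ) = q * f i + 1 := fun i => by linear_combination hf i
  have hq' : (2 : ℤ) ≤ q := by exact_mod_cast hq
  have hf0 : ∀ i, 0 ≤ f i := by
    intro i
    by_contra! h
    have := he i
    nlinarith [Int.natCast_nonneg (e i)]
  have hfsum : ∑ i, f i = q := by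
    have h1 : ∑ i, (e i : ℤ) = q ^ 2 + q + 1 := by exact_mod_cast hsum
    simp only [he, Finset.sum_add_distrib, ← Finset.mul_sum, Finset.sum_const, Finset.card_univ,
      hcard] at h1
    apply mul_left_cancel₀ (show (q : ℤ) ≠ 0 by positivity)
    simp only [nsmul_eq_mul, mul_one] at h1
    push_cast at h1
    linear_combination h1
  have hfsq : ∑ i, f i ^ 2 = q := by
    have h1 : ∑ i, (e i : ℤ) ^ 2 = (q + 1) * (q ^ 2 + 1) + q ^ 2 := by exact_mod_cast hsq
    have h2 : ∀ i, (e i : ℤ) ^ 2 = q ^ 2 * f i ^ 2 + 2 * q * f i + 1 := by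
      intro i; rw [he]; ring
    simp only [h2, Finset.sum_add_distrib, ← Finset.mul_sum, Finset.sum_const, Finset.card_univ,
      hcard, hfsum] at h1
    apply mul_left_cancel₀ (show (q : ℤ) ^ 2 ≠ 0 by positivity)
    simp only [nsmul_eq_mul, mul_one] at h1
    push_cast at h1
    linear_combination h1
  have hf01 : ∀ i, f i ^ 2 - f i = 0 := by
    have h0 : ∑ i, (f i ^ 2 - f i) = 0 := by rw [Finset.sum_sub_distrib, hfsum, hfsq, sub_self]
    have hnn : ∀ i ∈ Finset.univ, 0 ≤ f i ^ 2 - f i := fun i _ => by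
      rcases (hf0 i).eq_or_lt with h | h
      · simp [← h]
      · nlinarith
    exact fun i => (Finset.sum_eq_zero_iff_of_nonneg hnn).1 h0 i (Finset.mem_univ i)
  have hf01' : ∀ i, 1 - f i = 0 ∨ f i = 0 := fun i => by
    have := hf01 i
    have : (1 - f i) * f i = 0 := by linear_combination -this
    exact mul_eq_zero.1 this
  have hg : ∑ i, (1 - f i) = 1 := by
    rw [Finset.sum_sub_distrib, hfsum]; simp [hcard]
  obtain ⟨i₀, hi₀⟩ : ∃ i, 1 - f i ≠ 0 := by
    by_contra! h
    simp [h] at hg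
  have hi₀' : f i₀ = 0 := (hf01' i₀).resolve_left hi₀
  refine ⟨i₀, ?_, fun i hi => ?_⟩
  · zify; rw [he, hi₀']; simp
  · rw [← Finset.add_sum_erase _ _ (Finset.mem_univ i₀), hi₀'] at hg
    have h0 : ∑ i ∈ Finset.univ.erase i₀, (1 - f i) = 0 := by linarith
    have := (Finset.sum_eq_zero_iff_of_nonneg fun i _ => by
      rcases hf01' i with h | h <;> lia).1 h0 i (by simp [hi])
    zify
    rw [he]
    have : f i = 1 := by lia
    rw [this]; ring

theorem HasClassicalParameters.card_eq {G : Type*} [Group G] [Fintype G] {D : Finset G} {q : ℕ}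
    (hD : HasClassicalParameters D q 4) : D.card = q ^ 2 + q + 1 := by
  have hq := hD.isPrimePow.two_le
  rw [hD.isDifferenceSet.card_set]
  apply Nat.div_eq_of_eq_mul_left (by lia)
  have := Nat.one_le_pow 3 q (by lia)
  zify [this, show 1 ≤ q by lia]
  ring

theorem HasClassicalParameters.mul_inv_eq {G : Type*} [Group G] [Fintype G] {D : Finset G} {q : ℕ}
    (hD : HasClassicalParameters D q 4) : groupRingSum D * invMap (groupRingSum D) =
      ((q + 1 : ℕ) : ℤ) • groupRingSum Finset.univ +
        ((q ^ 2 : ℕ) : ℤ) • (1 : MonoidAlgebra ℤ G) := by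
  have hq := hD.isPrimePow.two_le
  have hlam : (q ^ (4 - 2) - 1) / (q - 1) = q + 1 := by
    apply Nat.div_eq_of_eq_mul_left (by lia)
    have := Nat.one_le_pow 2 q (by lia)
    zify [this, show 1 ≤ q by lia]
    ring
  rw [hD.isDifferenceSet.mul_inv_eq, ← hD.isDifferenceSet.card_set, hD.card_eq, hlam]
  congr 2
  push_cast
  ring

/-! ### Uniqueness of the subgroup of order `q ^ 2 + 1` -/

variable {G : Type*} [CommGroup G] {q : ℕ} {D : Finset G}

theorem isPrimePow_coprime_card {G : Type*} (hq : IsPrimePow q)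
    (hG : Nat.card G = (q + 1) * (q ^ 2 + 1)) : q.Coprime (Nat.card G) := by
  obtain ⟨p, s, hp, hs, rfl⟩ := hq
  exact hG ▸ (coprime_pow_add_one_mul_sq_add_one hp.nat_prime hs.ne').pow_left s

theorem card_quotient_of_card_eq (hG : Nat.card G = (q + 1) * (q ^ 2 + 1)) {K : Subgroup G}
    (hK : Nat.card K = q ^ 2 + 1) : Nat.card (G ⧸ K) = q + 1 := by
  have := Subgroup.card_eq_card_quotient_mul_card_subgroup K
  rw [hG, hK] at this
  exact (Nat.eq_of_mul_eq_mul_right (by positivity) this).symm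

theorem pow_mem_of_card_eq [Finite G] (hG : Nat.card G = (q + 1) * (q ^ 2 + 1)) {K : Subgroup G}
    (hK : Nat.card K = q ^ 2 + 1) (g : G) : g ^ (q + 1) ∈ K := by
  rw [← QuotientGroup.eq_one_iff, QuotientGroup.mk_pow, ← card_quotient_of_card_eq hG hK]
  exact pow_card_eq_one'

theorem sum_card_filter_mk (K : Subgroup G) [DecidableEq (G ⧸ K)] [Fintype (G ⧸ K)]
    (D : Finset G) : ∑ x, {d ∈ D | QuotientGroup.mk' K d = x}.card = D.card :=
  (Finset.card_eq_sum_card_fiberwise fun _ _ => Finset.mem_coe.2 (Finset.mem_univ _)).symm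

/-- A subgroup of order `(q ^ 2 + 1) / 2` cannot contain all `(q + 1)`-th powers. -/
theorem two_mul_card_ne [Fintype G] (hq : IsPrimePow q) (hG : Nat.card G = (q + 1) * (q ^ 2 + 1))
    (hD : HasClassicalParameters D q 4) (hnorm : IsNormalized D) {N : Subgroup G}
    (hN : ∀ g : G, g ^ (q + 1) ∈ N) : 2 * Nat.card N ≠ q ^ 2 + 1 := by
  classical
  intro hcard
  have hq2 := hq.two_le
  have hfix := powRingHom_eq_self_of_isNormalized hq hG hD.card_eq hD.mul_inv_eq hnorm
  have hquot : Nat.card (G ⧸ N) = 2 * (q + 1) := by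
    have := Subgroup.card_eq_card_quotient_mul_card_subgroup N
    have hpos : 0 < Nat.card N := Nat.card_pos
    apply Nat.eq_of_mul_eq_mul_right hpos
    rw [← this, hG, ← hcard]
    ring
  obtain ⟨c, hc⟩ : ∃ c, q + 1 = 2 * c := by
    have : Even (q ^ 2 + 1) := ⟨_, by rw [← hcard]; ring⟩
    have h2 : ¬ Even q := by
      intro h
      simp [Nat.even_add_one, Nat.even_pow, h] at this
    have : Even (q + 1) := by simpa [Nat.even_add_one] using h2
    exact even_iff_two_dvd.1 this
  have hmod := dvd_coeff_mapDomain_sub (QuotientGroup.mk' N) (QuotientGroup.mk'_surjective N) hq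
    (isPrimePow_coprime_card hq hG) (fun g => (QuotientGroup.eq_one_iff _).2 (hN g)) hfix
    hD.mul_inv_eq (c := c) (by
      rw [QuotientGroup.ker_mk', hquot, hD.card_eq]
      -- For `c = (q + 1) / 2` the expression vanishes exactly.
      refine ⟨0, ?_⟩
      have h1 : (2 : ℤ) * Nat.card N = q ^ 2 + 1 := by exact_mod_cast hcard
      have h2 : (q : ℤ) + 1 = 2 * c := by exact_mod_cast hc
      have h3 : (q : ℤ) = 2 * c - 1 := by linear_combination h2
      push_cast
      rw [h3] at h1 ⊢
      linear_combination c * h1)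
  -- Here `c < q`, so `c` is the least natural number in its class modulo `q`.
  have hle : ∀ x : G ⧸ N, c ≤ {d ∈ D | QuotientGroup.mk' N d = x}.card := by
    intro x
    obtain ⟨t, ht⟩ := hmod x
    rw [coeff_mapDomain_groupRingSum] at ht
    by_contra! h
    have : t ≤ -1 := by
      by_contra! h'
      have : 0 ≤ (q : ℤ) * t := mul_nonneg (by positivity) (by lia)
      lia
    have : (q : ℤ) * t ≤ q * (-1) := mul_le_mul_of_nonneg_left this (by positivity)
    lia
  -- The `2 (q + 1)` fibres would have total size at least `(q + 1) ^ 2 > q ^ 2 + q + 1`.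
  have := Finset.card_nsmul_le_sum Finset.univ _ c fun x _ => hle x
  rw [sum_card_filter_mk, hD.card_eq, Finset.card_univ, ← Nat.card_eq_fintype_card, hquot,
    smul_eq_mul, mul_right_comm, ← hc] at this
  nlinarith

/-- The index of `K ⊓ L` in `L` divides both `q + 1` and `q ^ 2 + 1`, hence `2`; index `2` is
excluded by `two_mul_card_ne`. -/
theorem subgroup_eq_of_card_eq [Fintype G] (hq : IsPrimePow q) (hG : Nat.card G = (q + 1) * (q ^ 2 + 1))
    (hD : HasClassicalParameters D q 4) (hnorm : IsNormalized D) {K L : Subgroup G}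
    (hK : Nat.card K = q ^ 2 + 1) (hL : Nat.card L = q ^ 2 + 1) : K = L := by
  have hN : ∀ g : G, g ^ (q + 1) ∈ K ⊓ L :=
    fun g => ⟨pow_mem_of_card_eq hG hK g, pow_mem_of_card_eq hG hL g⟩
  have hne := two_mul_card_ne hq hG hD hnorm hN
  have hmul : K.relIndex L * Nat.card (K ⊓ L : Subgroup G) = q ^ 2 + 1 := by
    have := Subgroup.relIndex_mul_relIndex ⊥ (K ⊓ L) L bot_le inf_le_right
    rwa [Subgroup.relIndex_bot_left, Subgroup.relIndex_bot_left, Subgroup.inf_relIndex_right,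
      hL, mul_comm] at this
  have hdvd : K.relIndex L ∣ q + 1 := by
    rw [← card_quotient_of_card_eq hG hK]
    exact Subgroup.relIndex_dvd_index_of_normal K L
  have hdvd2 : K.relIndex L ∣ 2 := by
    have h1 : K.relIndex L ∣ q ^ 2 + 1 := ⟨_, hmul.symm⟩
    have h2 : (K.relIndex L : ℤ) ∣ (q ^ 2 + 1 : ℕ) := by exact_mod_cast h1
    have h3 : (K.relIndex L : ℤ) ∣ (q + 1 : ℕ) := by exact_mod_cast hdvd
    have : ((2 : ℕ) : ℤ) = (q ^ 2 + 1 : ℕ) - (q + 1 : ℕ) * (q - 1) := by push_cast; ring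
    rw [← Int.natCast_dvd_natCast, this]
    exact dvd_sub h2 (h3.mul_right _)
  rcases (Nat.dvd_prime Nat.prime_two).1 hdvd2 with h | h
  · have hle : L ≤ K := Subgroup.relIndex_eq_one.1 h
    exact (Subgroup.eq_of_le_of_card_ge hle (by rw [hK, hL])).symm
  · rw [h] at hmul
    exact absurd hmul hne

end DiffSet

/-! ### The main theorem -/

theorem theorem5p1 {G : Type*} [CommGroup G] [Fintype G] (q : ℕ) (hq : IsPrimePow q)
    (hG : Nat.card G = (q + 1) * (q ^ 2 + 1)) (D : Finset G)
    (hD : DiffSet.HasClassicalParameters D q 4) (hnorm : DiffSet.IsNormalized D) :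
    (∃! K : Subgroup G, Nat.card K = q ^ 2 + 1) ∧
    ∀ K : Subgroup G, Nat.card K = q ^ 2 + 1 →
      (Set.range (DiffSet.coset K)).ncard = q + 1 ∧
      ∃ x₀ : G, DiffSet.interNumber D K x₀ = 1 ∧
        ∀ x : G, DiffSet.coset K x ≠ DiffSet.coset K x₀ →
          DiffSet.interNumber D K x = q + 1 := by
  classical
  obtain ⟨K₀, hK₀⟩ := CommGroup.exists_subgroup_card (hG ▸ dvd_mul_left (q ^ 2 + 1) (q + 1))
  refine ⟨⟨K₀, hK₀, fun L hL => DiffSet.subgroup_eq_of_card_eq hq hG hD hnorm hL hK₀⟩,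
    fun K hK => ⟨?_, ?_⟩⟩
  · rw [DiffSet.ncard_range_coset, DiffSet.card_quotient_of_card_eq hG hK]
  have hquot := DiffSet.card_quotient_of_card_eq hG hK
  have hfix := DiffSet.powRingHom_eq_self_of_isNormalized hq hG hD.card_eq hD.mul_inv_eq hnorm
  have hexp : ∀ g, QuotientGroup.mk' K g ^ (q + 1) = 1 := fun g =>
    (QuotientGroup.eq_one_iff _).2 (DiffSet.pow_mem_of_card_eq hG hK g)
  have hsurj := QuotientGroup.mk'_surjective K
  have hsum := DiffSet.sum_card_filter_mk K D
  have hsq := DiffSet.sum_card_fiber_sq _ hsurj hexp hfix hD.mul_inv_eq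
  have hmod := DiffSet.dvd_coeff_mapDomain_sub _ hsurj hq (DiffSet.isPrimePow_coprime_card hq hG)
    hexp hfix hD.mul_inv_eq (c := 1) (by
      rw [QuotientGroup.ker_mk', hquot, hK, hD.card_eq]
      -- `(q + 1) (q ^ 2 + 1) - 2 (q ^ 2 + q + 1) + (q + 1) = q ^ 2 (q - 1)`.
      exact ⟨q - 1, by push_cast; ring⟩)
  simp only [DiffSet.coeff_mapDomain_groupRingSum] at hmod
  rw [QuotientGroup.ker_mk', hK] at hsq
  rw [hD.card_eq] at hsum
  obtain ⟨y₀, h1, h2⟩ := DiffSet.exists_eq_one_and_eq_add_one hq.two_le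
    (by rw [← Nat.card_eq_fintype_card, hquot]) hmod hsum hsq
  obtain ⟨x₀, rfl⟩ := hsurj y₀
  refine ⟨x₀, by rw [DiffSet.interNumber_eq_card, h1], fun x hx => ?_⟩
  rw [DiffSet.interNumber_eq_card, h2]
  exact fun h => hx (DiffSet.coset_eq_coset_iff.2 h)
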